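/- Graphs are finite, simple and undirected. A set $D\subseteq V(G)$ is a dominating set of a graph $G$ if every vertex of $G$ belongs to $D$ or has a neighbor in $D$; $\gamma(G)$ denotes the minimum size of a dominating set of $G$; and $G$ is well-dominated if all of its inclusion-minimal dominating sets have the same size. The problem of recognizing well-dominated graphs can be solved in polynomial time in the class of graphs $G$ with $\gamma(G)=2$. That is, there are a (multi-stack) Turing machine $M$ and a polynomial $p$ such that, for every $n$ and every graph $G$ on the vertex set $\{0,\dots,n-1\}$ with $\gamma(G)=2$, the machine $M$, given the adjacency matrix of $G$ written row by row (with a separator after each row) as a word of length $N=n(n+1)$, halts within $p(N)$ steps and outputs "true" if $G$ is well-dominated and "false" otherwise. -/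

import Mathlib

namespace GraphDomination

section Domination

variable {V : Type*}

/-- The closed neighborhood `N[v] = {v} ∪ N(v)`. -/
def closedNeighborSet (G : SimpleGraph V) (v : V) : Set V :=
  insert v (G.neighborSet v)

/-- `D` is a dominating set of `G`: `N[D] = ⋃ v ∈ D, N[v]` is the whole vertex set. -/
def IsDominating (G : SimpleGraph V) (D : Finset V) : Prop :=
  (⋃ v ∈ D, closedNeighborSet G v) = Set.univ

/-- `D` is an inclusion-minimal dominating set of `G`. -/
def IsMinimalDominating (G : SimpleGraph V) (D : Finset V) : Prop :=
  Minimal (IsDominating G) D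

/-- The domination number `γ(G)` of a finite graph: the minimum size of a dominating set.
(The set of sizes is nonempty, because the set of all vertices is dominating.) -/
noncomputable def dominationNumber [Fintype V] (G : SimpleGraph V) : ℕ :=
  sInf {k : ℕ | ∃ D : Finset V, IsDominating G D ∧ D.card = k}

/-- `G` is well-dominated: all its minimal dominating sets have the same size. -/
def IsWellDominated (G : SimpleGraph V) : Prop :=
  ∀ D D' : Finset V, IsMinimalDominating G D → IsMinimalDominating G D' → D.card = D'.card

end Domination

/-- An instance of a graph problem: a finite simple graph whose vertices are numbered
`0, …, order - 1`. -/
structure FinGraph where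
  /-- the number of vertices -/
  order : ℕ
  /-- the graph -/
  graph : SimpleGraph (Fin order)

/-- The input word of a graph: its 0/1 adjacency matrix, written row by row over the three-letter
alphabet `Option Bool`; the letter `some b` is a matrix entry and the letter `none` ends a row.
A graph on `n` vertices has an input word of length `n * (n + 1)`. -/
noncomputable def FinGraph.encode (G : FinGraph) : List (Option Bool) :=
  open scoped Classical in
  (List.finRange G.order).flatMap fun i =>
    ((List.finRange G.order).map fun j => some (decide (G.graph.Adj i j))) ++ [none]

/-- The problem of recognizing the graphs with property `P` can be solved in polynomial time in
the class of graphs `C`: a single multi-stack Turing machine, started on the input word of any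
graph in `C`, halts within a number of steps that is polynomial in the length of that word, with
the one-letter output `true` if the graph has property `P` and `false` otherwise.
(No requirement is made on inputs outside the class `C`.) -/
def RecognizableInPolyTimeWithin (P C : FinGraph → Prop) : Prop :=
  open scoped Classical in
  Nonempty (Turing.TM2ComputableInPolyTime
    (fun G : {G : FinGraph // C G} => G.1.encode)
    Computability.encodeBool
    (fun G : {G : FinGraph // C G} => decide (P G.1)))

end GraphDomination

/-!
In a graph with domination number two, the minimal dominating sets have the same size if and only
if none of them has three elements (`isWellDominated_iff`). A minimal dominating set `D` with three
distinct elements `a`, `b`, `c` has private neighbors `p`, `q`, `r` of these, and lies in the union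
of `{a, b, c}` with the set of vertices outside `N[p] ∪ N[q] ∪ N[r]`; so this union is dominating.
Conversely, if for some six vertices with the right adjacencies this union is dominating, then
every minimal dominating set inside it contains `a`, `b` and `c`, because inside the union only `a`
dominates `p`, only `b` dominates `q`, and only `c` dominates `r` (`exists_three_le_card_iff`). So
the graphs in question are the ones that violate a fixed first-order formula with eight variables
(`decides_exists_isPrivateTriple`), and trying all assignments takes polynomial time.

For the machine model, `StackProg` is a small structured programming language with a cost
semantics `StackProg.Exec`, and `StackProg.Exec.reachesIn` shows that the compiled form of a
program runs within that cost on a multi-stack machine. A variable of a formula is a pair of unary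
counters `left i`, `right i` whose sum is the order of the graph. The class of formulas that are
decided by such programs in polynomial time (`Decides`) contains the atomic formulas
(`decides_le`, `decides_adjAt`) and is closed under the connectives and under quantification over
the vertices (`Decides.exists`); `Decides.recognizable` turns a program for a closed formula into a
polynomial-time Turing machine.
-/

open Turing

/-! ### Structured programs for multi-stack machines -/

namespace GraphDomination

section StackProg

variable {K : Type} {Γ : K → Type} {τ : Type}

/-- Structured programs over stacks with alphabets `Γ` and a register with values in `τ`. The tests
of `ite` and `while` may read the register and the top letter of one stack (`none` if that stack
is empty), and leave both unchanged. -/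
inductive StackProg (Γ : K → Type) (τ : Type) : Type
  | load (f : τ → τ) : StackProg Γ τ
  | push (k : K) (f : τ → Γ k) : StackProg Γ τ
  | pop (k : K) : StackProg Γ τ
  | seq (p q : StackProg Γ τ) : StackProg Γ τ
  | ite (k : K) (g : τ → Option (Γ k) → Bool) (p q : StackProg Γ τ) : StackProg Γ τ
  | while (k : K) (g : τ → Option (Γ k) → Bool) (p : StackProg Γ τ) : StackProg Γ τ

namespace StackProg

/-- `Exec p s s' n`: started in the state `s`, the program `p` terminates in the state `s'`, and
its compiled form (see `StackProg.code`) needs at most `n` steps for this. -/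
inductive Exec [DecidableEq K] :
    StackProg Γ τ → τ × (∀ k, List (Γ k)) → τ × (∀ k, List (Γ k)) → ℕ → Prop
  | load {f t S} : Exec (.load f) (t, S) (f t, S) 1
  | push {k f t S} : Exec (.push k f) (t, S) (t, Function.update S k (f t :: S k)) 1
  | pop {k t S} : Exec (.pop k) (t, S) (t, Function.update S k (S k).tail) 1
  | seq {p q s s' s'' a b} : Exec p s s' a → Exec q s' s'' b → Exec (.seq p q) s s'' (a + b)
  | ite_true {k g p q s s' a} : g s.1 (s.2 k).head? = true → Exec p s s' a →
      Exec (.ite k g p q) s s' (a + 1)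
  | ite_false {k g p q s s' a} : g s.1 (s.2 k).head? = false → Exec q s s' a →
      Exec (.ite k g p q) s s' (a + 1)
  | while_true {k g p s s' s'' a b} : g s.1 (s.2 k).head? = true → Exec p s s' a →
      Exec (.while k g p) s' s'' b → Exec (.while k g p) s s'' (a + b + 1)
  | while_false {k g p s} : g s.1 (s.2 k).head? = false → Exec (.while k g p) s s 1
  | mono {p s s' a b} : Exec p s s' a → a ≤ b → Exec p s s' b

/-- The labels of the compiled form of a program: one for every atomic instruction and every
test. -/
def Label : StackProg Γ τ → Type
  | load _ => Unit
  | push _ _ => Unit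
  | pop _ => Unit
  | seq p q => Label p ⊕ Label q
  | ite _ _ p q => Option (Label p ⊕ Label q)
  | .while _ _ p => Option (Label p)

instance Label.finite : ∀ p : StackProg Γ τ, Finite (Label p)
  | load _ => inferInstanceAs (Finite Unit)
  | push _ _ => inferInstanceAs (Finite Unit)
  | pop _ => inferInstanceAs (Finite Unit)
  | seq p q =>
    have := Label.finite p
    have := Label.finite q
    inferInstanceAs (Finite (Label p ⊕ Label q))
  | ite _ _ p q =>
    have := Label.finite p
    have := Label.finite q
    inferInstanceAs (Finite (Option (Label p ⊕ Label q)))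
  | .while _ _ p =>
    have := Label.finite p
    inferInstanceAs (Finite (Option (Label p)))

/-- The label at which the compiled form of a program is entered. -/
def entry : ∀ p : StackProg Γ τ, Label p
  | load _ => ()
  | push _ _ => ()
  | pop _ => ()
  | seq p _ => .inl (entry p)
  | ite _ _ _ _ => none
  | .while _ _ _ => none

/-- The compiled form of a program as code of a multi-stack machine, for an embedding `ι` of the
labels of the program into the labels `Λ` of the machine. On termination the code jumps to `e`.
The internal states of the machine carry, besides the register of the program, a truth value that
holds the outcome of the latest test. -/
def code {Λ : Type} : ∀ p : StackProg Γ τ, (Label p → Λ) → Λ → Label p → TM2.Stmt Γ Λ (τ × Bool)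
  | load f, _, e, _ => .load (fun s => (f s.1, s.2)) (.goto fun _ => e)
  | push k f, _, e, _ => .push k (fun s => f s.1) (.goto fun _ => e)
  | pop k, _, e, _ => .pop k (fun s _ => s) (.goto fun _ => e)
  | seq p q, ι, _, .inl l => code p (fun l => ι (.inl l)) (ι (.inr (entry q))) l
  | seq _ q, ι, e, .inr l => code q (fun l => ι (.inr l)) e l
  | ite k g p q, ι, _, none => .peek k (fun s a => (s.1, g s.1 a)) (.branch Prod.snd
      (.goto fun _ => ι (some (.inl (entry p)))) (.goto fun _ => ι (some (.inr (entry q)))))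
  | ite _ _ p _, ι, e, some (.inl l) => code p (fun l => ι (some (.inl l))) e l
  | ite _ _ _ q, ι, e, some (.inr l) => code q (fun l => ι (some (.inr l))) e l
  | .while k g p, ι, e, none => .peek k (fun s a => (s.1, g s.1 a)) (.branch Prod.snd
      (.goto fun _ => ι (some (entry p))) (.goto fun _ => e))
  | .while _ _ p, ι, _, some l => code p (fun l => ι (some l)) (ι none) l

variable [DecidableEq K]

/-- The machine `M` gets from the configuration `c` to the configuration `c'` in at most `n`
steps. -/
def ReachesIn {Λ σ : Type} (M : Λ → TM2.Stmt Γ Λ σ) (c c' : TM2.Cfg Γ Λ σ) (n : ℕ) : Prop :=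
  ∃ m ≤ n, (flip bind (TM2.step M))^[m] (some c) = some c'

theorem ReachesIn.trans {Λ σ : Type} {M : Λ → TM2.Stmt Γ Λ σ} {c₁ c₂ c₃ : TM2.Cfg Γ Λ σ} {a b : ℕ}
    (h₁ : ReachesIn M c₁ c₂ a) (h₂ : ReachesIn M c₂ c₃ b) : ReachesIn M c₁ c₃ (a + b) := by
  obtain ⟨m₁, hm₁, h₁⟩ := h₁
  obtain ⟨m₂, hm₂, h₂⟩ := h₂
  refine ⟨m₂ + m₁, by omega, ?_⟩
  rw [Function.iterate_add_apply, h₁, h₂]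

theorem ReachesIn.mono {Λ σ : Type} {M : Λ → TM2.Stmt Γ Λ σ} {c c' : TM2.Cfg Γ Λ σ} {a b : ℕ}
    (h : ReachesIn M c c' a) (hab : a ≤ b) : ReachesIn M c c' b := by
  obtain ⟨m, hm, h⟩ := h
  exact ⟨m, hm.trans hab, h⟩

theorem ReachesIn.single {Λ σ : Type} {M : Λ → TM2.Stmt Γ Λ σ} {l : Λ} {v : σ}
    {S : ∀ k, List (Γ k)} {c : TM2.Cfg Γ Λ σ} (h : TM2.stepAux (M l) v S = c) :
    ReachesIn M ⟨some l, v, S⟩ c 1 :=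
  ⟨1, le_rfl, congrArg some h⟩

/-- The compiled form of a program does what the program does: in every machine that contains the
compiled form, a terminating execution is followed step by step. -/
theorem Exec.reachesIn {Λ : Type} {M : Λ → TM2.Stmt Γ Λ (τ × Bool)} {p : StackProg Γ τ}
    {s s' : τ × (∀ k, List (Γ k))} {n : ℕ} (h : Exec p s s' n) :
    ∀ {ι : Label p → Λ} {e : Λ}, (∀ l, M (ι l) = code p ι e l) → ∀ b : Bool,
      ∃ b' : Bool, ReachesIn M ⟨some (ι (entry p)), (s.1, b), s.2⟩ ⟨some e, (s'.1, b'), s'.2⟩ n := by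
  induction h with
  | load =>
    intro ι e hM b
    exact ⟨b, .single (by rw [hM]; rfl)⟩
  | push =>
    intro ι e hM b
    exact ⟨b, .single (by rw [hM]; rfl)⟩
  | pop =>
    intro ι e hM b
    exact ⟨b, .single (by rw [hM]; rfl)⟩
  | seq _ _ ih₁ ih₂ =>
    intro ι e hM b
    obtain ⟨b₁, h₁⟩ := ih₁ (ι := fun l => ι (.inl l)) (fun l => hM (.inl l)) b
    obtain ⟨b₂, h₂⟩ := ih₂ (ι := fun l => ι (.inr l)) (fun l => hM (.inr l)) b₁
    exact ⟨b₂, h₁.trans h₂⟩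
  | ite_true hg _ ih =>
    intro ι e hM b
    obtain ⟨b', h⟩ := ih (ι := fun l => ι (some (.inl l))) (fun l => hM (some (.inl l))) true
    refine ⟨b', ((ReachesIn.single ?_).trans h).mono (by omega)⟩
    rw [hM]
    simp [code, entry, hg]
  | ite_false hg _ ih =>
    intro ι e hM b
    obtain ⟨b', h⟩ := ih (ι := fun l => ι (some (.inr l))) (fun l => hM (some (.inr l))) false
    refine ⟨b', ((ReachesIn.single ?_).trans h).mono (by omega)⟩
    rw [hM]
    simp [code, entry, hg]
  | while_true hg _ _ ih₁ ih₂ =>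
    intro ι e hM b
    obtain ⟨b₁, h₁⟩ := ih₁ (ι := fun l => ι (some l)) (fun l => hM (some l)) true
    obtain ⟨b₂, h₂⟩ := ih₂ hM b₁
    refine ⟨b₂, (((ReachesIn.single ?_).trans h₁).trans h₂).mono (by omega)⟩
    rw [hM]
    simp [code, entry, hg]
  | while_false hg =>
    intro ι e hM b
    refine ⟨false, .single ?_⟩
    rw [hM]
    simp [code, entry, hg]
  | mono _ hab ih =>
    intro ι e hM b
    obtain ⟨b', h⟩ := ih hM b
    exact ⟨b', h.mono hab⟩

theorem Exec.congr {p : StackProg Γ τ} {s s' s'' : τ × (∀ k, List (Γ k))} {a b : ℕ}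
    (h : Exec p s s' a) (hs : s' = s'') (hab : a ≤ b) : Exec p s s'' b :=
  hs ▸ h.mono hab

/-- The loop rule: `f 0, …, f a` are the states at the successive tests. -/
theorem Exec.iterate {k : K} {g : τ → Option (Γ k) → Bool} {p : StackProg Γ τ} {c : ℕ} (a : ℕ)
    (f : ℕ → τ × (∀ k, List (Γ k)))
    (hg : ∀ j < a, g (f j).1 ((f j).2 k).head? = true)
    (hp : ∀ j < a, Exec p (f j) (f (j + 1)) c)
    (ha : g (f a).1 ((f a).2 k).head? = false) :
    Exec (.while k g p) (f 0) (f a) (a * (c + 1) + 1) := by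
  induction a generalizing f with
  | zero => simpa using Exec.while_false ha
  | succ a ih =>
    refine (Exec.while_true (hg 0 (by omega)) (hp 0 (by omega))
      (ih (fun j => f (j + 1)) (fun j hj => hg _ (by omega)) (fun j hj => hp _ (by omega)) ha)).mono
      (le_of_eq (by ring))

end StackProg

end StackProg

end GraphDomination

/-! ### Stacks and basic programs for graphs -/

namespace GraphDomination

section GraphProg

/-- The stacks of the machines that evaluate a formula with `m` variables on a graph. -/
inductive Stack (m : ℕ) : Type
  /-- the input stack -/
  | inp
  /-- holds the part of the input that has been read, in reversed order -/
  | aux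
  /-- holds the part of a counter that has been read -/
  | tmp
  /-- a counter for comparisons -/
  | ctr
  /-- the output stack -/
  | out
  /-- the height of `left i` is the value of the variable `i` -/
  | left (i : Fin m)
  /-- the height of `right i` is the order of the graph minus the value of the variable `i` -/
  | right (i : Fin m)
  deriving DecidableEq, Fintype

/-- The alphabets of the stacks. -/
def Stack.Letter {m : ℕ} : Stack m → Type
  | inp => Option Bool
  | aux => Option Bool
  | out => Bool
  | _ => Unit

/-- Programs for the evaluation of formulas. Their register holds a truth value. -/
abbrev GraphProg (m : ℕ) : Type := StackProg (Stack.Letter (m := m)) Bool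

/-- The contents of all stacks; unary counters are given by their heights. -/
def contents {m : ℕ} (w v : List (Option Bool)) (t c : ℕ) (o : List Bool) (x y : Fin m → ℕ) :
    ∀ k : Stack m, List k.Letter
  | .inp => w
  | .aux => v
  | .tmp => List.replicate t ()
  | .ctr => List.replicate c ()
  | .out => o
  | .left i => List.replicate (x i) ()
  | .right i => List.replicate (y i) ()

open Stack

namespace StackProg

variable {m : ℕ} {b : Bool} {w v : List (Option Bool)} {a : Option Bool} {t c : ℕ} {o : List Bool}
  {x y : Fin m → ℕ}

section Instructions

theorem exec_pop' {k : Stack m} {S S' : ∀ k : Stack m, List k.Letter}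
    (h : Function.update S k (S k).tail = S') : Exec (pop k : GraphProg m) (b, S) (b, S') 1 :=
  h ▸ Exec.pop

theorem exec_push' {k : Stack m} {f : Bool → k.Letter} {S S' : ∀ k : Stack m, List k.Letter}
    (h : Function.update S k (f b :: S k) = S') :
    Exec (push k f : GraphProg m) (b, S) (b, S') 1 :=
  h ▸ Exec.push

theorem exec_pop_inp : Exec (pop inp : GraphProg m) (b, contents (a :: w) v t c o x y)
    (b, contents w v t c o x y) 1 :=
  exec_pop' (by funext k; cases k <;> rfl)

theorem exec_pop_aux : Exec (pop aux : GraphProg m) (b, contents w (a :: v) t c o x y)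
    (b, contents w v t c o x y) 1 :=
  exec_pop' (by funext k; cases k <;> rfl)

theorem exec_pop_tmp : Exec (pop tmp : GraphProg m) (b, contents w v (t + 1) c o x y)
    (b, contents w v t c o x y) 1 :=
  exec_pop' (by funext k; cases k <;> rfl)

theorem exec_pop_ctr : Exec (pop ctr : GraphProg m) (b, contents w v t c o x y)
    (b, contents w v t (c - 1) o x y) 1 :=
  exec_pop' (by funext k; cases k <;> first | rfl | (cases c <;> rfl))

theorem exec_pop_left (i : Fin m) : Exec (pop (left i) : GraphProg m) (b, contents w v t c o x y)
    (b, contents w v t c o (Function.update x i (x i - 1)) y) 1 := by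
  refine exec_pop' (funext fun k => ?_)
  cases k with
  | left j =>
    by_cases h : j = i
    · subst h
      rw [Function.update_self]
      simp only [contents, Function.update_self]
      exact List.tail_replicate
    · rw [Function.update_of_ne (by simpa using h)]
      simp [contents, Function.update_of_ne h]
  | _ => rfl

theorem exec_pop_right (i : Fin m) : Exec (pop (right i) : GraphProg m)
    (b, contents w v t c o x y) (b, contents w v t c o x (Function.update y i (y i - 1))) 1 := by
  refine exec_pop' (funext fun k => ?_)
  cases k with
  | right j =>
    by_cases h : j = i
    · subst h
      rw [Function.update_self]
      simp only [contents, Function.update_self]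
      exact List.tail_replicate
    · rw [Function.update_of_ne (by simpa using h)]
      simp [contents, Function.update_of_ne h]
  | _ => rfl

theorem exec_push_inp : Exec (push inp fun _ => a : GraphProg m) (b, contents w v t c o x y)
    (b, contents (a :: w) v t c o x y) 1 :=
  exec_push' (by funext k; cases k <;> rfl)

theorem exec_push_aux : Exec (push aux fun _ => a : GraphProg m) (b, contents w v t c o x y)
    (b, contents w (a :: v) t c o x y) 1 :=
  exec_push' (by funext k; cases k <;> rfl)

theorem exec_push_out : Exec (push out fun b => b : GraphProg m) (b, contents w v t c o x y)
    (b, contents w v t c (b :: o) x y) 1 :=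
  exec_push' (by funext k; cases k <;> rfl)

theorem exec_push_tmp : Exec (push tmp fun _ => () : GraphProg m) (b, contents w v t c o x y)
    (b, contents w v (t + 1) c o x y) 1 :=
  exec_push' (by funext k; cases k <;> rfl)

theorem exec_push_ctr : Exec (push ctr fun _ => () : GraphProg m) (b, contents w v t c o x y)
    (b, contents w v t (c + 1) o x y) 1 :=
  exec_push' (by funext k; cases k <;> rfl)

theorem exec_push_left (i : Fin m) : Exec (push (left i) fun _ => () : GraphProg m)
    (b, contents w v t c o x y)
    (b, contents w v t c o (Function.update x i (x i + 1)) y) 1 := by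
  refine exec_push' (funext fun k => ?_)
  cases k with
  | left j =>
    by_cases h : j = i
    · subst h
      rw [Function.update_self]
      simp only [contents, Function.update_self]
      rfl
    · rw [Function.update_of_ne (by simpa using h)]
      simp [contents, Function.update_of_ne h]
  | _ => rfl

theorem exec_push_right (i : Fin m) : Exec (push (right i) fun _ => () : GraphProg m)
    (b, contents w v t c o x y)
    (b, contents w v t c o x (Function.update y i (y i + 1))) 1 := by
  refine exec_push' (funext fun k => ?_)
  cases k with
  | right j =>
    by_cases h : j = i
    · subst h
      rw [Function.update_self]
      simp only [contents, Function.update_self]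
      rfl
    · rw [Function.update_of_ne (by simpa using h)]
      simp [contents, Function.update_of_ne h]
  | _ => rfl

end Instructions

/-- Move the top letter of the input stack to the stack `aux`. -/
def advance : GraphProg m :=
  .ite inp (fun _ (a : Option (Option Bool)) => decide (a = some (some true)))
    (.seq (pop inp) (push aux fun _ => some true))
    (.ite inp (fun _ (a : Option (Option Bool)) => decide (a = some (some false)))
      (.seq (pop inp) (push aux fun _ => some false))
      (.seq (pop inp) (push aux fun _ => none)))

/-- Move the top letter of the stack `aux` to the input stack. -/
def retreat : GraphProg m :=
  .ite aux (fun _ (a : Option (Option Bool)) => decide (a = some (some true)))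
    (.seq (pop aux) (push inp fun _ => some true))
    (.ite aux (fun _ (a : Option (Option Bool)) => decide (a = some (some false)))
      (.seq (pop aux) (push inp fun _ => some false))
      (.seq (pop aux) (push inp fun _ => none)))

theorem exec_advance : Exec (advance : GraphProg m) (b, contents (a :: w) v t c o x y)
    (b, contents w (a :: v) t c o x y) 4 := by
  rcases a with _ | _ | _
  · exact .mono (.ite_false rfl (.ite_false rfl (.seq exec_pop_inp exec_push_aux))) le_rfl
  · exact .mono (.ite_false rfl (.ite_true rfl (.seq exec_pop_inp exec_push_aux))) le_rfl
  · exact .mono (.ite_true rfl (.seq exec_pop_inp exec_push_aux)) (by omega)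

theorem exec_retreat : Exec (retreat : GraphProg m) (b, contents w (a :: v) t c o x y)
    (b, contents (a :: w) v t c o x y) 4 := by
  rcases a with _ | _ | _
  · exact .mono (.ite_false rfl (.ite_false rfl (.seq exec_pop_aux exec_push_inp))) le_rfl
  · exact .mono (.ite_false rfl (.ite_true rfl (.seq exec_pop_aux exec_push_inp))) le_rfl
  · exact .mono (.ite_true rfl (.seq exec_pop_aux exec_push_inp)) (by omega)

/-- Move the letters on the stack `aux` back to the input stack. -/
def rewind : GraphProg m := .while aux (fun _ a => a.isSome) retreat

theorem exec_rewind : Exec (rewind : GraphProg m) (b, contents w v t c o x y)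
    (b, contents (v.reverse ++ w) [] t c o x y) (v.length * 5 + 1) := by
  induction v generalizing w with
  | nil => exact .mono (.while_false rfl) (by simp)
  | cons a v ih =>
    rw [List.reverse_cons, List.append_assoc, List.singleton_append]
    exact .mono (.while_true rfl exec_retreat ih) (by simp only [List.length_cons]; omega)

/-- Skip the input up to the next end of a row. -/
def skipRow : GraphProg m :=
  .seq (.while inp (fun _ (a : Option (Option Bool)) => decide (a ≠ some none)) advance) advance

theorem exec_skipRow (r : List Bool) :
    Exec (skipRow : GraphProg m) (b, contents (r.map some ++ none :: w) v t c o x y)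
      (b, contents w (none :: ((r.map some).reverse ++ v)) t c o x y) (r.length * 5 + 5) := by
  have h : Exec (.while inp (fun _ (a : Option (Option Bool)) => decide (a ≠ some none)) advance : GraphProg m)
      (b, contents (r.map some ++ none :: w) v t c o x y)
      (b, contents (none :: w) ((r.map some).reverse ++ v) t c o x y) (r.length * 5 + 1) := by
    induction r generalizing v with
    | nil => exact .mono (.while_false rfl) (by simp)
    | cons a r ih =>
      rw [List.map_cons, List.reverse_cons, List.append_assoc, List.singleton_append]
      exact .mono (.while_true rfl exec_advance ih) (by simp only [List.length_cons]; omega)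
  exact .mono (.seq h exec_advance) (by omega)

/-- Execute `p` as often as the value of the variable `i` says. -/
def forEach (i : Fin m) (p : GraphProg m) : GraphProg m :=
  .seq (.while (left i) (fun _ a => a.isSome)
      (.seq (pop (left i)) (.seq (push tmp fun _ => ()) p)))
    (.while tmp (fun _ a => a.isSome) (.seq (pop tmp) (push (left i) fun _ => ())))

/-- `f j`, `g j` and `d j` describe the input, its part that has been read, and the counter for
comparisons after `j` executions of `p`. -/
theorem exec_forEach {i : Fin m} {p : GraphProg m} {n : ℕ} (f g : ℕ → List (Option Bool))
    (d : ℕ → ℕ)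
    (h : ∀ j < x i, ∀ t x, Exec p (b, contents (f j) (g j) t (d j) o x y)
      (b, contents (f (j + 1)) (g (j + 1)) t (d (j + 1)) o x y) n) :
    Exec (forEach i p) (b, contents (f 0) (g 0) 0 (d 0) o x y)
      (b, contents (f (x i)) (g (x i)) 0 (d (x i)) o x y) (x i * (n + 6) + 2) := by
  have h₁ := Exec.iterate (k := left i) (g := fun _ a => a.isSome)
    (p := (.seq (pop (left i)) (.seq (push tmp fun _ => ()) p) : GraphProg m)) (c := n + 2) (x i)
    (fun j => (b, contents (f j) (g j) j (d j) o (Function.update x i (x i - j)) y))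
    (fun j hj => by
      obtain ⟨e, he⟩ : ∃ e, x i - j = e + 1 := ⟨x i - j - 1, by omega⟩
      simp only [contents, Function.update_self, he]
      rfl)
    (fun j hj => by
      have := Exec.mono (.seq (exec_pop_left (x := Function.update x i (x i - j)) (y := y) i)
        (.seq (exec_push_tmp (t := j)) (h j hj _ _))) (show _ ≤ n + 2 by omega)
      simpa [Nat.sub_sub] using this)
    (by simp only [contents, Function.update_self, Nat.sub_self]; rfl)
  have h₂ := Exec.iterate (k := tmp) (g := fun _ a => a.isSome)
    (p := (.seq (pop tmp) (push (left i) fun _ => ()) : GraphProg m)) (c := 2) (x i)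
    (fun j => (b, contents (f (x i)) (g (x i)) (x i - j) (d (x i)) o (Function.update x i j) y))
    (fun j hj => by
      obtain ⟨e, he⟩ : ∃ e, x i - j = e + 1 := ⟨x i - j - 1, by omega⟩
      simp only [contents, he]
      rfl)
    (fun j hj => by
      obtain ⟨e, he⟩ : ∃ e, x i - j = e + 1 := ⟨x i - j - 1, by omega⟩
      have he' : x i - (j + 1) = e := by omega
      simp only [he, he']
      simpa using Exec.seq (exec_pop_tmp (t := e)) (exec_push_left (x := Function.update x i j) i))
    (by simp only [contents, Nat.sub_self]; rfl)
  simp only [Nat.sub_zero, Function.update_eq_self, Nat.sub_self] at h₁ h₂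
  exact .mono (.seq h₁ h₂) (le_of_eq (by ring))

end StackProg

end GraphProg

end GraphDomination

/-! ### First-order formulas decided in polynomial time -/

namespace GraphDomination

section Decides

open Stack StackProg Polynomial

/-- The row of a vertex in the adjacency matrix. -/
noncomputable def FinGraph.row (G : FinGraph) (i : Fin G.order) : List Bool :=
  open scoped Classical in
  (List.finRange G.order).map fun j => decide (G.graph.Adj i j)

theorem FinGraph.length_row (G : FinGraph) (i : Fin G.order) : (G.row i).length = G.order := by
  simp [FinGraph.row]

/-- The part of the input word that belongs to the vertices in `l`. -/
noncomputable def FinGraph.encodeRows (G : FinGraph) (l : List (Fin G.order)) :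
    List (Option Bool) :=
  l.flatMap fun i => (G.row i).map some ++ [none]

theorem FinGraph.encodeRows_finRange (G : FinGraph) :
    G.encodeRows (List.finRange G.order) = G.encode := by
  simp only [FinGraph.encodeRows, FinGraph.encode, FinGraph.row, List.map_map]
  rfl

theorem FinGraph.encodeRows_cons (G : FinGraph) (i : Fin G.order) (l : List (Fin G.order)) :
    G.encodeRows (i :: l) = (G.row i).map some ++ none :: G.encodeRows l := by
  simp [FinGraph.encodeRows]

theorem FinGraph.encodeRows_append (G : FinGraph) (l l' : List (Fin G.order)) :
    G.encodeRows (l ++ l') = G.encodeRows l ++ G.encodeRows l' := by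
  simp [FinGraph.encodeRows]

theorem FinGraph.length_encodeRows (G : FinGraph) (l : List (Fin G.order)) :
    (G.encodeRows l).length = l.length * (G.order + 1) := by
  induction l with
  | nil => simp [FinGraph.encodeRows]
  | cons i l ih =>
    simp only [encodeRows_cons, List.length_append, List.length_map, length_row,
      List.length_cons, ih]
    ring

theorem FinGraph.length_encode (G : FinGraph) : G.encode.length = G.order * (G.order + 1) := by
  rw [← encodeRows_finRange, length_encodeRows, List.length_finRange]

theorem FinGraph.count_none_encode (G : FinGraph) : G.encode.count none = G.order := by
  have h (l : List (Fin G.order)) : (G.encodeRows l).count none = l.length := by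
    induction l with
    | nil => simp [FinGraph.encodeRows]
    | cons i l ih =>
      have : ((G.row i).map some).count none = 0 := List.count_eq_zero.2 (by simp)
      rw [encodeRows_cons, List.count_append, this, List.count_cons_self, ih, List.length_cons,
        zero_add]
  rw [← encodeRows_finRange, h, List.length_finRange]

variable {m : ℕ}

/-- The stacks while a formula is evaluated on the graph `G` under the assignment `x`. -/
noncomputable def FinGraph.stacks (G : FinGraph) (x : Fin m → ℕ) :
    ∀ k : Stack m, List k.Letter :=
  contents G.encode [] 0 0 [] x fun i => G.order - x i

/-- The formula `φ` in the variables `0, …, k - 1` is decided by a program within polynomial time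
in the order of the graph. An assignment gives the number of a vertex to each of these variables
and the value `0` to the other ones, which the program may use. -/
def Decides (k : ℕ) (φ : FinGraph → (Fin m → ℕ) → Prop) : Prop :=
  open scoped Classical in
  ∃ (p : GraphProg m) (T : ℕ[X]), ∀ (G : FinGraph) (x : Fin m → ℕ) (b : Bool),
    (∀ i : Fin m, i.val < k → x i < G.order) → (∀ i : Fin m, k ≤ i.val → x i = 0) →
      Exec p (b, G.stacks x) (decide (φ G x), G.stacks x) (T.eval G.order)

theorem Decides.not {k : ℕ} {φ : FinGraph → (Fin m → ℕ) → Prop} (h : Decides k φ) :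
    Decides k fun G x => ¬ φ G x := by
  classical
  obtain ⟨p, T, h⟩ := h
  refine ⟨.seq p (.load Bool.not), T + 1, fun G x b h₁ h₂ => ?_⟩
  have := Exec.seq (h G x b h₁ h₂) (.load (f := Bool.not))
  simpa using this

theorem Decides.and {k : ℕ} {φ ψ : FinGraph → (Fin m → ℕ) → Prop} (h : Decides k φ)
    (h' : Decides k ψ) : Decides k fun G x => φ G x ∧ ψ G x := by
  classical
  obtain ⟨p, T, h⟩ := h
  obtain ⟨q, T', h'⟩ := h'
  refine ⟨.seq p (.ite inp (fun b _ => b) q (.load id)), T + T' + 2, fun G x b h₁ h₂ => ?_⟩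
  specialize h G x b h₁ h₂
  by_cases hφ : φ G x
  · have := h.seq (.ite_true (k := inp) (g := fun b _ => b) (q := .load id) (decide_eq_true hφ)
      (h' G x _ h₁ h₂))
    simp only [hφ, true_and]
    exact this.mono (by simp; omega)
  · have := h.seq (.ite_false (k := inp) (g := fun b _ => b) (p := q) (decide_eq_false hφ)
      (.load (f := id)))
    simp only [hφ, decide_false, id, false_and] at this ⊢
    exact this.mono (by simp)

theorem Decides.or {k : ℕ} {φ ψ : FinGraph → (Fin m → ℕ) → Prop} (h : Decides k φ)
    (h' : Decides k ψ) : Decides k fun G x => φ G x ∨ ψ G x := by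
  simpa only [not_and_or, not_not] using (h.not.and h'.not).not

/-- The values of a variable are tried one after the other, until the formula holds or all vertices
have been tried; then the variable is reset to `0`. -/
theorem Decides.exists {k : ℕ} (hk : k < m) {φ : FinGraph → (Fin m → ℕ) → Prop}
    (h : Decides (k + 1) φ) :
    Decides k fun G x => ∃ v < G.order, φ G (Function.update x ⟨k, hk⟩ v) := by
  classical
  obtain ⟨p, T, h⟩ := h
  set i : Fin m := ⟨k, hk⟩ with hi
  let body : GraphProg m := .seq p (.seq (pop (right i)) (push (left i) fun _ => ()))
  let loop : GraphProg m := .while (right i) (fun b a => !b && a.isSome) body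
  let back : GraphProg m := .while (left i) (fun _ a => a.isSome)
    (.seq (pop (left i)) (push (right i) fun _ => ()))
  refine ⟨.seq (.load fun _ => false) (.seq loop back), (X + 1) * (T + 8), ?_⟩
  intro G x b h₁ h₂
  have hx : x i = 0 := h₂ i le_rfl
  -- The program for `φ` is followed by an increment of the variable.
  have hbody (v : ℕ) (hv : v < G.order) (b : Bool) :
      Exec body (b, G.stacks (Function.update x i v))
        (decide (φ G (Function.update x i v)), G.stacks (Function.update x i (v + 1)))
        (T.eval G.order + 2) := by
    have hp := h G (Function.update x i v) b
      (fun j hj => by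
        by_cases hji : j = i
        · simpa [hji] using hv
        · rw [Function.update_of_ne hji]
          exact h₁ j (by have : j.val ≠ k := fun h => hji (Fin.ext h); omega))
      (fun j hj => by
        have hji : j ≠ i := fun h => by rw [h, hi] at hj; simp at hj
        rw [Function.update_of_ne hji]
        exact h₂ j (by omega))
    refine (hp.seq (.seq (exec_pop_right i) (exec_push_left i))).congr ?_ (by omega)
    simp only [Function.update_self, Function.update_idem, FinGraph.stacks]
    congr 2
    funext j
    by_cases hji : j = i
    · subst hji
      simp only [Function.update_self]
      omega
    · simp only [Function.update_of_ne hji]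
  -- The loop stops at the first value that satisfies `φ`.
  have hloop (d : ℕ) : ∀ v, v + d = G.order → ∃ v' ≤ G.order,
      Exec loop (decide (∃ u < v, φ G (Function.update x i u)), G.stacks (Function.update x i v))
        (decide (∃ u < G.order, φ G (Function.update x i u)),
          G.stacks (Function.update x i v')) (d * (T.eval G.order + 3) + 1) := by
    induction d with
    | zero =>
      intro v hv
      obtain rfl : v = G.order := hv
      refine ⟨_, le_rfl, .mono (.while_false ?_) (by omega)⟩
      simp only [FinGraph.stacks, contents, Function.update_self, Nat.sub_self]
      simp
    | succ d ih =>
      intro v hv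
      by_cases hφ : ∃ u < v, φ G (Function.update x i u)
      · refine ⟨v, by omega, .mono (.congr (.while_false (by simp [hφ])) ?_ le_rfl) (by omega)⟩
        obtain ⟨u, hu, hφu⟩ := hφ
        rw [decide_eq_true ⟨u, hu, hφu⟩, decide_eq_true ⟨u, by omega, hφu⟩]
      · obtain ⟨v', hv', hl⟩ := ih (v + 1) (by omega)
        refine ⟨v', hv', .mono (.while_true ?_ ((hbody v (by omega) _).congr ?_ le_rfl) hl)
          (le_of_eq (by ring))⟩
        · obtain ⟨e, he⟩ : ∃ e, G.order - v = e + 1 := ⟨G.order - v - 1, by omega⟩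
          simp only [hφ, FinGraph.stacks, contents, Function.update_self, he]
          rfl
        · have : φ G (Function.update x i v) ↔ ∃ u < v + 1, φ G (Function.update x i u) := by
            refine ⟨fun h => ⟨v, by omega, h⟩, fun ⟨u, hu, h⟩ => ?_⟩
            rcases Nat.lt_succ_iff_lt_or_eq.1 hu with hu | rfl
            · exact absurd ⟨u, hu, h⟩ hφ
            · exact h
          simp only [this]
  obtain ⟨v, hv, hl⟩ := hloop G.order 0 (by omega)
  have hback := Exec.iterate (k := left i) (g := fun _ a => a.isSome)
    (p := (.seq (pop (left i)) (push (right i) fun _ => ()) : GraphProg m)) (c := 2) v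
    (fun j => (decide (∃ u < G.order, φ G (Function.update x i u)),
      G.stacks (Function.update x i (v - j))))
    (fun j hj => by
      obtain ⟨e, he⟩ : ∃ e, v - j = e + 1 := ⟨v - j - 1, by omega⟩
      simp only [FinGraph.stacks, contents, Function.update_self, he]
      rfl)
    (fun j hj => by
      refine (Exec.seq (exec_pop_left i) (exec_push_right i)).congr ?_ le_rfl
      simp only [Function.update_self, Function.update_idem, FinGraph.stacks, Nat.sub_sub]
      congr 2
      funext j'
      by_cases hji : j' = i
      · subst hji
        simp only [Function.update_self]
        omega
      · simp only [Function.update_of_ne hji])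
    (by simp [FinGraph.stacks, contents])
  have hx0 : Function.update x i 0 = x := by rw [← hx, Function.update_eq_self]
  simp only [Nat.sub_zero, Nat.sub_self, hx0] at hback
  simp only [not_lt_zero, false_and, exists_false, decide_false, hx0] at hl
  refine .congr (.seq .load (.seq hl hback)) (Prod.ext (decide_eq_decide.2 .rfl) rfl) ?_
  simp only [eval_mul, eval_add, eval_X, eval_one, eval_ofNat]
  nlinarith

/-- Comparison of two variables: the counter `ctr` is raised to the value of `i` and lowered by the
value of `j`. Since popping from an empty stack does nothing, it ends at the truncated difference,
which is zero if and only if the value of `i` is at most that of `j`. -/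
theorem decides_le {k : ℕ} {i j : Fin m} (hi : i.val < k) (hj : j.val < k) :
    Decides k fun _ x => x i ≤ x j := by
  classical
  refine ⟨.seq (forEach i (push ctr fun _ => ())) (.seq (forEach j (pop ctr))
    (.seq (.ite ctr (fun _ a => a.isNone) (.load fun _ => true) (.load fun _ => false))
      (.while ctr (fun _ a => a.isSome) (pop ctr)))), 16 * (X + 1), fun G x b h₁ h₂ => ?_⟩
  have e₁ := exec_forEach (i := i) (x := x) (b := b) (o := []) (y := fun i => G.order - x i)
    (p := push ctr fun _ => ()) (n := 1) (fun _ => G.encode) (fun _ => []) (fun r => r)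
    (fun r _ t x => exec_push_ctr)
  have e₂ := exec_forEach (i := j) (x := x) (b := b) (o := []) (y := fun i => G.order - x i)
    (p := pop ctr) (n := 1) (fun _ => G.encode) (fun _ => []) (fun r => x i - r)
    (fun r _ t x => exec_pop_ctr)
  have e₃ : Exec (.ite ctr (fun _ a => a.isNone) (.load fun _ => true) (.load fun _ => false) :
      GraphProg m) (b, contents G.encode [] 0 (x i - x j) [] x fun i => G.order - x i)
      (decide (x i ≤ x j), contents G.encode [] 0 (x i - x j) [] x fun i => G.order - x i) 2 := by
    by_cases hij : x i ≤ x j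
    · simp only [hij, decide_true, Nat.sub_eq_zero_of_le hij]
      exact .ite_true rfl .load
    · obtain ⟨e, he⟩ : ∃ e, x i - x j = e + 1 := ⟨x i - x j - 1, by omega⟩
      simp only [hij, decide_false, he]
      exact .ite_false rfl .load
  have e₄ := Exec.iterate (k := ctr) (g := fun _ a => a.isSome) (p := (pop ctr : GraphProg m))
    (c := 1) (x i - x j)
    (fun r => (decide (x i ≤ x j),
      contents G.encode [] 0 (x i - x j - r) [] x fun i => G.order - x i))
    (fun r hr => by
      obtain ⟨e, he⟩ : ∃ e, x i - x j - r = e + 1 := ⟨x i - x j - r - 1, by omega⟩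
      simp only [he]
      rfl)
    (fun r hr => exec_pop_ctr)
    (by simp [contents])
  simp only [Nat.sub_zero, Nat.sub_self] at e₂ e₄
  refine .congr (e₁.seq (e₂.seq (e₃.seq e₄))) (Prod.ext (decide_eq_decide.2 .rfl) rfl) ?_
  have := h₁ i hi
  have := h₁ j hj
  simp only [eval_mul, eval_add, eval_X, eval_one, eval_ofNat]
  omega

theorem decides_eq {k : ℕ} {i j : Fin m} (hi : i.val < k) (hj : j.val < k) :
    Decides k fun _ x => x i = x j := by
  simpa only [le_antisymm_iff] using (decides_le hi hj).and (decides_le hj hi)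

/-- The vertices with the numbers `a` and `b` are adjacent. -/
def FinGraph.AdjAt (G : FinGraph) (a b : ℕ) : Prop :=
  ∃ (ha : a < G.order) (hb : b < G.order), G.graph.Adj ⟨a, ha⟩ ⟨b, hb⟩

/-- To find an entry of the adjacency matrix, as many rows are skipped as the value of `i` says,
and then as many letters as the value of `j` says. -/
theorem decides_adjAt {k : ℕ} {i j : Fin m} (hi : i.val < k) (hj : j.val < k) :
    Decides k fun G x => G.AdjAt (x i) (x j) := by
  classical
  refine ⟨.seq (forEach i skipRow) (.seq (forEach j advance)
    (.seq (.ite inp (fun _ (a : Option (Option Bool)) => decide (a = some (some true)))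
      (.load fun _ => true) (.load fun _ => false)) rewind)), 26 * (X + 1) * (X + 1),
    fun G x b h₁ h₂ => ?_⟩
  have hxi := h₁ i hi
  have hxj := h₁ j hj
  have e₁ := exec_forEach (i := i) (x := x) (b := b) (o := []) (y := fun i => G.order - x i)
    (p := skipRow) (n := G.order * 5 + 5)
    (fun r => G.encodeRows ((List.finRange G.order).drop r))
    (fun r => (G.encodeRows ((List.finRange G.order).take r)).reverse) (fun _ => 0)
    (fun r hr t x => by
      have hr' : r < (List.finRange G.order).length := by simp; omega
      rw [List.drop_eq_getElem_cons hr', G.encodeRows_cons,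
        ← List.take_append_getElem hr', G.encodeRows_append, G.encodeRows_cons]
      refine (exec_skipRow _).congr ?_ (by rw [FinGraph.length_row])
      simp [FinGraph.encodeRows])
  have hi' : x i < (List.finRange G.order).length := by simpa using hxi
  -- The part of the input from the row of `x i` on.
  set w := G.encodeRows ((List.finRange G.order).drop (x i)) with hw
  set v := G.encodeRows ((List.finRange G.order).take (x i)) with hv
  have hvw : v ++ w = G.encode := by
    rw [hv, hw, ← FinGraph.encodeRows_append, List.take_append_drop, FinGraph.encodeRows_finRange]
  have hlen : v.length + w.length = G.order * (G.order + 1) := by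
    rw [← List.length_append, hvw, FinGraph.length_encode]
  have hw' : w = (G.row ⟨x i, hxi⟩).map some ++
      none :: G.encodeRows ((List.finRange G.order).drop (x i + 1)) := by
    rw [hw, List.drop_eq_getElem_cons hi', G.encodeRows_cons]
    simp
  have hjw : x j < w.length := by
    rw [hw']; simp [FinGraph.length_row]; omega
  have hget : w[x j] = some (decide (G.graph.Adj ⟨x i, hxi⟩ ⟨x j, hxj⟩)) := by
    simp only [hw']
    rw [List.getElem_append_left (by simpa [FinGraph.length_row] using hxj)]
    simp [FinGraph.row]
  have e₂ := exec_forEach (i := j) (x := x) (b := b) (o := []) (y := fun i => G.order - x i)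
    (p := advance) (n := 4) (fun r => w.drop r) (fun r => (w.take r).reverse ++ v.reverse)
    (fun _ => 0)
    (fun r hr t x => by
      have hr' : r < w.length := by omega
      rw [List.drop_eq_getElem_cons hr', ← List.take_append_getElem hr', List.reverse_append]
      exact exec_advance)
  have e₃ : Exec (.ite inp (fun _ (a : Option (Option Bool)) => decide (a = some (some true)))
      (.load fun _ => true) (.load fun _ => false) : GraphProg m)
      (b, contents (w.drop (x j)) ((w.take (x j)).reverse ++ v.reverse) 0 0 [] x
        fun i => G.order - x i)
      (decide (G.AdjAt (x i) (x j)),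
        contents (w.drop (x j)) ((w.take (x j)).reverse ++ v.reverse) 0 0 [] x
        fun i => G.order - x i) 2 := by
    rw [List.drop_eq_getElem_cons hjw, hget]
    by_cases hA : G.graph.Adj ⟨x i, hxi⟩ ⟨x j, hxj⟩
    · have hA' : G.AdjAt (x i) (x j) := ⟨hxi, hxj, hA⟩
      simp only [hA, hA', decide_true]
      exact .ite_true rfl .load
    · have hA' : ¬ G.AdjAt (x i) (x j) := fun ⟨_, _, h⟩ => hA h
      simp only [hA, hA', decide_false]
      exact .ite_false rfl .load
  have e₄ := exec_rewind (m := m) (b := decide (G.AdjAt (x i) (x j))) (w := w.drop (x j))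
    (v := (w.take (x j)).reverse ++ v.reverse) (t := 0) (c := 0) (o := []) (x := x)
    (y := fun i => G.order - x i)
  have hend : ((w.take (x j)).reverse ++ v.reverse).reverse ++ w.drop (x j) = G.encode := by
    simp [hvw]
  rw [hend] at e₄
  simp only [List.drop_zero, List.take_zero, FinGraph.encodeRows_finRange] at e₁ e₂
  refine .mono (.seq e₁ (.seq e₂ (.seq e₃ e₄))) ?_
  simp only [eval_mul, eval_add, eval_X, eval_one, eval_ofNat, List.length_append,
    List.length_reverse, List.length_take, min_eq_left hjw.le]
  have h₃ : x i * (G.order * 5 + 5 + 6) ≤ G.order * (G.order * 5 + 5 + 6) :=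
    Nat.mul_le_mul_right _ hxi.le
  nlinarith

end Decides

end GraphDomination

/-! ### From programs to Turing machines -/

namespace GraphDomination

section Machine

open Stack StackProg Polynomial

variable {m : ℕ} {b : Bool} {w v : List (Option Bool)} {y : Fin m → ℕ}

/-- Increment all counters `right i` for `i` in `l`. -/
def incRight (l : List (Fin m)) : GraphProg m :=
  l.foldr (fun i p => .seq (push (right i) fun _ => ()) p) (.load id)

theorem exec_incRight {l : List (Fin m)} :
    Exec (incRight l) (b, contents w v 0 0 [] (fun _ => 0) y)
      (b, contents w v 0 0 [] (fun _ => 0) (fun i => y i + l.count i)) (l.length + 1) := by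
  induction l generalizing y with
  | nil => exact .load
  | cons i l ih =>
    refine .congr (.seq (exec_push_right i) ih) ?_ (by simp only [List.length_cons]; omega)
    congr 2
    funext j
    by_cases hji : j = i
    · subst hji
      rw [Function.update_self, List.count_cons_self]
      omega
    · rw [Function.update_of_ne hji, List.count_cons_of_ne (Ne.symm hji)]

/-- Set the counters `right i` to the order of the input graph, which is the number of row ends in
the input. -/
def setup : GraphProg m :=
  .seq (.while inp (fun _ a => a.isSome)
    (.seq (.ite inp (fun _ (a : Option (Option Bool)) => decide (a = some none))
      (incRight (List.finRange m)) (.load id)) advance)) rewind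

theorem exec_setup :
    Exec (setup : GraphProg m) (b, contents w [] 0 0 [] (fun _ => 0) fun _ => 0)
      (b, contents w [] 0 0 [] (fun _ => 0) fun _ => w.count none)
      (w.length * (m + 12) + 2) := by
  have h : ∀ (v : List (Option Bool)) (n : ℕ), Exec (.while inp (fun _ a => a.isSome)
      (.seq (.ite inp (fun _ (a : Option (Option Bool)) => decide (a = some none))
        (incRight (List.finRange m)) (.load id)) advance) : GraphProg m)
      (b, contents w v 0 0 [] (fun _ => 0) fun _ => n)
      (b, contents [] (w.reverse ++ v) 0 0 [] (fun _ => 0) fun _ => n + w.count none)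
      (w.length * (m + 7) + 1) := by
    induction w with
    | nil => exact fun v n => .mono (.while_false rfl) (by simp)
    | cons a w ih =>
      intro v n
      rw [List.reverse_cons, List.append_assoc, List.singleton_append]
      rcases a with _ | a
      · have hi := (exec_incRight (b := b) (w := none :: w) (v := v) (y := fun _ : Fin m => n)
          (l := List.finRange m)).congr (s'' := (b, contents (none :: w) v 0 0 [] (fun _ => 0)
            fun _ => n + 1)) (by simp [List.count_eq_one_of_mem (List.nodup_finRange m)])
          (b := m + 1) (by simp)
        refine .congr (.while_true rfl (.seq (.ite_true rfl hi) exec_advance)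
          (ih (none :: v) (n + 1))) ?_ ?_
        · rw [List.count_cons_self, add_assoc n, add_comm 1]
        · simp only [List.length_cons]
          ring_nf
          omega
      · refine .congr (.while_true rfl (.seq (.ite_false rfl .load) exec_advance)
          (ih (some a :: v) n)) ?_ ?_
        · simp
        · simp only [List.length_cons]
          ring_nf
          omega
  refine .congr (.seq (h [] 0) exec_rewind) ?_ ?_
  · simp
  · simp; ring_nf; omega

/-- Empty the counters `right i` for `i` in `l`. -/
def clearRight (l : List (Fin m)) : GraphProg m :=
  l.foldr (fun i p => .seq (.while (right i) (fun _ a => a.isSome) (pop (right i))) p) (.load id)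

theorem exec_clearRight {l : List (Fin m)} {n : ℕ} (hy : ∀ i ∉ l, y i = 0) (hn : ∀ i, y i ≤ n) :
    Exec (clearRight l) (b, contents w v 0 0 [] (fun _ => 0) y)
      (b, contents w v 0 0 [] (fun _ => 0) fun _ => 0) (l.length * (n * 2 + 1) + 1) := by
  induction l generalizing y with
  | nil =>
    obtain rfl : y = fun _ => 0 := funext fun i => hy i (by simp)
    exact .mono .load (by simp)
  | cons i l ih =>
    have h := Exec.iterate (k := right i) (g := fun _ a => a.isSome)
      (p := (pop (right i) : GraphProg m)) (c := 1) (y i)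
      (fun j => (b, contents w v 0 0 [] (fun _ => 0) (Function.update y i (y i - j))))
      (fun j hj => by
        obtain ⟨e, he⟩ : ∃ e, y i - j = e + 1 := ⟨y i - j - 1, by omega⟩
        simp only [contents, Function.update_self, he]
        rfl)
      (fun j hj => by
        refine (exec_pop_right i).congr ?_ le_rfl
        simp only [Function.update_self, Function.update_idem, Nat.sub_sub])
      (by simp [contents])
    simp only [Nat.sub_zero, Nat.sub_self, Function.update_eq_self] at h
    refine .mono (h.seq (ih (fun j hj => ?_) (fun j => ?_))) ?_
    · by_cases hji : j = i
      · rw [hji, Function.update_self]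
      · rw [Function.update_of_ne hji]
        exact hy j (by simp [hji, hj])
    · by_cases hji : j = i
      · rw [hji, Function.update_self]
        exact Nat.zero_le n
      · rw [Function.update_of_ne hji]
        exact hn j
    · have := hn i
      rw [List.length_cons, Nat.succ_mul]
      omega

/-- Empty the input stack. -/
def clearInp : GraphProg m := .while inp (fun _ a => a.isSome) (pop inp)

theorem exec_clearInp : Exec (clearInp : GraphProg m)
    (b, contents w v 0 0 [] (fun _ => 0) y) (b, contents [] v 0 0 [] (fun _ => 0) y)
    (w.length * 2 + 1) := by
  induction w with
  | nil => exact .while_false rfl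
  | cons a w ih =>
    exact .mono (.while_true rfl exec_pop_inp ih) (by simp only [List.length_cons]; omega)

/-- The machine that executes a program and halts. -/
noncomputable def machine (p : GraphProg m) : FinTM2 where
  K := Stack m
  k₀ := inp
  k₁ := out
  Γ := Letter
  Λ := Option (Label p)
  main := some (entry p)
  ΛFin := Fintype.ofFinite _
  σ := Bool × Bool
  initialState := (false, false)
  Γk₀Fin := inferInstanceAs (Fintype (Option Bool))
  m
  | some l => code p some none l
  | none => .load (fun s => (s.1, false)) .halt

theorem initList_machine (p : GraphProg m) (w : List (Option Bool)) :
    initList (machine p) w =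
      ⟨some (some (entry p)), (false, false), contents w [] 0 0 [] (fun _ => 0) fun _ => 0⟩ := by
  refine congrArg (TM2.Cfg.mk _ _) (funext fun k => ?_)
  cases k <;> rfl

theorem haltList_machine (p : GraphProg m) (b : Bool) :
    haltList (machine p) [b] =
      ⟨none, (false, false), contents [] [] 0 0 [b] (fun _ => 0) fun _ => 0⟩ := by
  refine congrArg (TM2.Cfg.mk _ _) (funext fun k => ?_)
  cases k <;> rfl

theorem machine_reachesIn {p : GraphProg m} {n : ℕ}
    (h : Exec p (false, contents w [] 0 0 [] (fun _ => 0) fun _ => 0)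
      (false, contents [] [] 0 0 [b] (fun _ => 0) fun _ => 0) n) :
    ReachesIn (machine p).m (initList (machine p) w) (haltList (machine p) [b]) (n + 1) := by
  obtain ⟨b', hr⟩ := h.reachesIn (M := (machine p).m) (ι := some) (e := none) (fun _ => rfl) false
  rw [initList_machine, haltList_machine]
  exact hr.trans (.single rfl)

/-- What a formula without free variables expresses is recognizable in polynomial time. -/
theorem Decides.recognizable {φ : FinGraph → (Fin m → ℕ) → Prop} (h : Decides 0 φ)
    {P C : FinGraph → Prop} (hφ : ∀ G, C G → (P G ↔ φ G fun _ => 0)) :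
    RecognizableInPolyTimeWithin P C := by
  classical
  obtain ⟨p, T, hp⟩ := h
  let q : GraphProg m := .seq setup (.seq p (.seq clearInp (.seq (clearRight (List.finRange m))
    (.seq (push out fun b => b) (.load fun _ => false)))))
  have hq (G : FinGraph) (hG : C G) :
      Exec q (false, contents G.encode [] 0 0 [] (fun _ => 0) fun _ => 0)
        (false, contents [] [] 0 0 [decide (P G)] (fun _ => 0) fun _ => 0)
        (G.encode.length * (m + 14) + T.eval G.order + m * (G.order * 2 + 1) + 6) := by
    have e₁ := exec_setup (m := m) (b := false) (w := G.encode)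
    have e₂ := hp G (fun _ => 0) false (fun i hi => by omega) (fun _ _ => rfl)
    have e₃ := exec_clearRight (b := decide (φ G fun _ => 0)) (l := List.finRange m) (w := [])
      (v := []) (y := fun _ => G.order - 0) (n := G.order) (fun i hi => by simp at hi)
      (fun i => by simp)
    rw [FinGraph.count_none_encode] at e₁
    simp only [hφ G hG]
    refine .mono (e₁.seq (e₂.seq (exec_clearInp.seq (e₃.seq (exec_push_out.seq .load))))) ?_
    simp; ring_nf; omega
  have hT {N n : ℕ} (hn : n ≤ N) : T.eval n ≤ T.eval N := by
    simp only [eval_eq_sum]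
    exact Finset.sum_le_sum fun i _ => Nat.mul_le_mul_left _ (Nat.pow_le_pow_left hn i)
  refine ⟨⟨⟨machine q, Equiv.refl _, Equiv.refl _⟩,
    X * ((m + 14 : ℕ) : ℕ[X]) + T + (m : ℕ[X]) * (X * 2 + 1) + 7, fun G => ?_⟩⟩
  have hG := (machine_reachesIn (hq G.1 G.2)).mono (b := G.1.encode.length * (m + 14) +
      T.eval G.1.encode.length + m * (G.1.encode.length * 2 + 1) + 7) (by
    have hn : G.1.order ≤ G.1.encode.length := by
      rw [FinGraph.length_encode]
      exact Nat.le_mul_of_pos_right _ (Nat.succ_pos _)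
    have := hT hn
    have := Nat.mul_le_mul_left m (show G.1.order * 2 + 1 ≤ G.1.encode.length * 2 + 1 by omega)
    omega)
  choose steps hsteps heq using hG
  refine ⟨⟨steps, ?_⟩, ?_⟩
  · have hw : G.1.encode.map (Equiv.refl (Option Bool)).invFun = G.1.encode := List.map_id _
    rw [← hw] at heq
    exact heq
  · simpa using hsteps

end Machine

end GraphDomination

/-! ### Minimal dominating sets with three elements -/

namespace GraphDomination

section ThreePrivate

variable {V : Type*} {G : SimpleGraph V}

theorem isDominating_iff {D : Finset V} :
    IsDominating G D ↔ ∀ v, ∃ u ∈ D, v = u ∨ G.Adj u v := by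
  simp [IsDominating, Set.eq_univ_iff_forall, closedNeighborSet]

/-- Every vertex of a minimal dominating set has a private neighbor. -/
theorem IsMinimalDominating.exists_private {D : Finset V} (hD : IsMinimalDominating G D) {a : V}
    (ha : a ∈ D) : ∃ p, ∀ u ∈ D, (p = u ∨ G.Adj u p) ↔ u = a := by
  classical
  by_contra! h
  refine (Finset.erase_ssubset ha).not_subset (hD.le_of_le (isDominating_iff.2 fun v => ?_)
    (Finset.erase_subset a D))
  obtain ⟨u, hu, huv⟩ := isDominating_iff.1 hD.prop v
  by_cases hua : u = a
  · subst hua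
    obtain ⟨w, hw, h⟩ := h v
    rcases h with ⟨h₁, h₂⟩ | ⟨h₁, h₂⟩
    · exact ⟨w, Finset.mem_erase.2 ⟨h₂, hw⟩, h₁⟩
    · subst h₂
      exact absurd huv (by tauto)
  · exact ⟨u, Finset.mem_erase.2 ⟨hua, hu⟩, huv⟩

/-- `p`, `q`, `r` are private neighbors of `a`, `b`, `c` in the set that consists of `a`, `b`, `c`
and all vertices outside the closed neighborhoods of `p`, `q`, `r`, and this set is dominating. -/
def IsPrivateTriple (G : SimpleGraph V) (a b c p q r : V) : Prop :=
  ((p = a ∨ G.Adj a p) ∧ ¬ (p = b ∨ G.Adj b p) ∧ ¬ (p = c ∨ G.Adj c p)) ∧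
  (¬ (q = a ∨ G.Adj a q) ∧ (q = b ∨ G.Adj b q) ∧ ¬ (q = c ∨ G.Adj c q)) ∧
  (¬ (r = a ∨ G.Adj a r) ∧ ¬ (r = b ∨ G.Adj b r) ∧ (r = c ∨ G.Adj c r)) ∧
  ∀ v, (v = a ∨ G.Adj a v) ∨ (v = b ∨ G.Adj b v) ∨ (v = c ∨ G.Adj c v) ∨
    ∃ u, (v = u ∨ G.Adj u v) ∧ ¬ (p = u ∨ G.Adj u p) ∧ ¬ (q = u ∨ G.Adj u q) ∧
      ¬ (r = u ∨ G.Adj u r)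

/-- A private triple yields a dominating set in which only `a` dominates `p`, only `b` dominates
`q`, and only `c` dominates `r`; so `a`, `b` and `c` are in all its dominating subsets. -/
theorem exists_three_le_card_iff [Fintype V] :
    (∃ D, IsMinimalDominating G D ∧ 3 ≤ D.card) ↔ ∃ a b c p q r, IsPrivateTriple G a b c p q r := by
  classical
  constructor
  · rintro ⟨D, hD, hcard⟩
    obtain ⟨a, ha, b, hb, c, hc, hab, hac, hbc⟩ := Finset.two_lt_card.1 hcard
    obtain ⟨p, hp⟩ := hD.exists_private ha
    obtain ⟨q, hq⟩ := hD.exists_private hb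
    obtain ⟨r, hr⟩ := hD.exists_private hc
    refine ⟨a, b, c, p, q, r, ?_, ?_, ?_, fun v => ?_⟩
    · rw [hp a ha, hp b hb, hp c hc]; exact ⟨rfl, hab.symm, hac.symm⟩
    · rw [hq a ha, hq b hb, hq c hc]; exact ⟨hab, rfl, hbc.symm⟩
    · rw [hr a ha, hr b hb, hr c hc]; exact ⟨hac, hbc, rfl⟩
    · obtain ⟨u, hu, huv⟩ := isDominating_iff.1 hD.prop v
      by_cases hua : u = a
      · subst hua; exact .inl huv
      by_cases hub : u = b
      · subst hub; exact .inr (.inl huv)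
      by_cases huc : u = c
      · subst huc; exact .inr (.inr (.inl huv))
      refine .inr (.inr (.inr ⟨u, huv, ?_⟩))
      rw [hp u hu, hq u hu, hr u hu]
      exact ⟨hua, hub, huc⟩
  · rintro ⟨a, b, c, p, q, r, ⟨hpa, hpb, hpc⟩, ⟨hqa, hqb, hqc⟩, ⟨hra, hrb, hrc⟩, h⟩
    set D : Finset V := {a, b, c} ∪ Finset.univ.filter fun u =>
      ¬ (p = u ∨ G.Adj u p) ∧ ¬ (q = u ∨ G.Adj u q) ∧ ¬ (r = u ∨ G.Adj u r) with hDdef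
    have hmem (u : V) : u ∈ D ↔ (u = a ∨ u = b ∨ u = c) ∨
        ¬ (p = u ∨ G.Adj u p) ∧ ¬ (q = u ∨ G.Adj u q) ∧ ¬ (r = u ∨ G.Adj u r) := by
      simp [hDdef, or_assoc]
    have hD : IsDominating G D := by
      refine isDominating_iff.2 fun v => ?_
      rcases h v with h | h | h | ⟨u, huv, hu⟩
      · exact ⟨a, by simp [hmem], h⟩
      · exact ⟨b, by simp [hmem], h⟩
      · exact ⟨c, by simp [hmem], h⟩
      · exact ⟨u, (hmem u).2 (.inr hu), huv⟩
    obtain ⟨D', hD'D, hD'⟩ := exists_minimal_le_of_wellFoundedLT (IsDominating G) D hD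
    have hdom := isDominating_iff.1 hD'.prop
    have ha : a ∈ D' := by
      obtain ⟨u, hu, hup⟩ := hdom p
      rcases (hmem u).1 (hD'D hu) with (rfl | rfl | rfl) | hu'
      · exact hu
      · exact absurd hup hpb
      · exact absurd hup hpc
      · exact absurd hup hu'.1
    have hb : b ∈ D' := by
      obtain ⟨u, hu, huq⟩ := hdom q
      rcases (hmem u).1 (hD'D hu) with (rfl | rfl | rfl) | hu'
      · exact absurd huq hqa
      · exact hu
      · exact absurd huq hqc
      · exact absurd huq hu'.2.1
    have hc : c ∈ D' := by
      obtain ⟨u, hu, hur⟩ := hdom r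
      rcases (hmem u).1 (hD'D hu) with (rfl | rfl | rfl) | hu'
      · exact absurd hur hra
      · exact absurd hur hrb
      · exact hu
      · exact absurd hur hu'.2.2
    refine ⟨D', hD', Finset.two_lt_card.2 ⟨a, ha, b, hb, c, hc, ?_, ?_, ?_⟩⟩
    · rintro rfl; exact hpb hpa
    · rintro rfl; exact hpc hpa
    · rintro rfl; exact hqc hqb

theorem isWellDominated_iff [Fintype V] (h : dominationNumber G = 2) :
    IsWellDominated G ↔ ¬ ∃ a b c p q r, IsPrivateTriple G a b c p q r := by
  have hle {D : Finset V} (hD : IsDominating G D) : 2 ≤ D.card := h ▸ Nat.sInf_le ⟨D, hD, rfl⟩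
  rw [← exists_three_le_card_iff]
  constructor
  · rintro hG ⟨D, hD, hcard⟩
    obtain ⟨D₀, hD₀, hcard₀⟩ : ∃ D : Finset V, IsDominating G D ∧ D.card = 2 := by
      have := Nat.sInf_mem (s := {k : ℕ | ∃ D : Finset V, IsDominating G D ∧ D.card = k})
        ⟨_, Finset.univ, isDominating_iff.2 fun v => ⟨v, Finset.mem_univ v, .inl rfl⟩, rfl⟩
      rwa [← dominationNumber, h] at this
    -- A minimum dominating set is inclusion-minimal.
    have hmin : IsMinimalDominating G D₀ := ⟨hD₀, fun D' hD' hsub =>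
      (Finset.eq_of_subset_of_card_le hsub (hcard₀ ▸ hle hD')).ge⟩
    have := hG D D₀ hD hmin
    omega
  · intro hG D D' hD hD'
    have := hle hD.prop
    have := hle hD'.prop
    have : ¬ 3 ≤ D.card := fun h => hG ⟨D, hD, h⟩
    have : ¬ 3 ≤ D'.card := fun h => hG ⟨D', hD', h⟩
    omega

end ThreePrivate

end GraphDomination

/-! ### The formula for graphs that are not well-dominated -/

namespace GraphDomination

section Formula

variable {m k : ℕ}

/-- The vertex with the number `b` is in the closed neighborhood of the vertex with the
number `a`. -/
def FinGraph.DominatesAt (G : FinGraph) (a b : ℕ) : Prop := b = a ∨ G.AdjAt a b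

theorem FinGraph.dominatesAt_iff {G : FinGraph} {u v : Fin G.order} :
    v = u ∨ G.graph.Adj u v ↔ G.DominatesAt u v := by
  simp [FinGraph.DominatesAt, FinGraph.AdjAt, Fin.ext_iff]

theorem decides_dominatesAt {i j : Fin m} (hi : i.val < k) (hj : j.val < k) :
    Decides k fun G x => G.DominatesAt (x i) (x j) :=
  (decides_eq hj hi).or (decides_adjAt hi hj)

/-- Existence of a private triple as a formula; the variables `0, …, 7` stand for `a`, `b`, `c`,
`p`, `q`, `r`, `v`, `u` in `IsPrivateTriple`. -/
theorem decides_exists_isPrivateTriple :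
    ∃ φ : FinGraph → (Fin 8 → ℕ) → Prop, Decides 0 φ ∧
      ∀ G x, φ G x ↔ ∃ a b c p q r, IsPrivateTriple G.graph a b c p q r := by
  have hN {k : ℕ} (i j : Fin 8) (hi : i.val < k := by decide) (hj : j.val < k := by decide) :=
    decides_dominatesAt hi hj
  have h₈ := ((hN (k := 8) 7 6).and
    ((hN 7 3).not.and ((hN 7 4).not.and (hN 7 5).not))).exists (k := 7) (by decide)
  -- The universal quantifier over `v` is expressed as `¬ ∃ v, ¬ …`.
  have h₇ := ((hN (k := 7) 0 6).or ((hN 1 6).or ((hN 2 6).or h₈))).not.exists (k := 6) (by decide)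
  have h₆ := ((hN (k := 6) 0 3).and ((hN 1 3).not.and (hN 2 3).not)).and
    (((hN 0 4).not.and ((hN 1 4).and (hN 2 4).not)).and
    (((hN 0 5).not.and ((hN 1 5).not.and (hN 2 5))).and h₇.not))
  have h := (((((h₆.exists (k := 5) (by decide)).exists (k := 4) (by decide)).exists
    (k := 3) (by decide)).exists (k := 2) (by decide)).exists (k := 1) (by decide)).exists
    (k := 0) (by decide)
  refine ⟨_, h, fun G x => ?_⟩
  simp only [IsPrivateTriple, FinGraph.dominatesAt_iff, Fin.exists_iff, Fin.forall_iff,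
    exists_prop, Function.update_apply]
  simp [or_iff_not_imp_left]

end Formula

end GraphDomination

theorem corollary5p3 :
    GraphDomination.RecognizableInPolyTimeWithin
      (fun G => GraphDomination.IsWellDominated G.graph)
      (fun G => GraphDomination.dominationNumber G.graph = 2) := by
  obtain ⟨φ, hφ, h⟩ := GraphDomination.decides_exists_isPrivateTriple
  exact hφ.not.recognizable fun G hG => (GraphDomination.isWellDominated_iff hG).trans (h G _).not.symm
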